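/- **Setting.** Let $\mathcal X\subset\mathbb R^n$ be compact with $\mathcal X=\overline{\operatorname{int}\mathcal X}$ and let $\mathcal T\subset[0,\infty)$ be compact. Fix a box $\prod_k[a_k,b_k]\supseteq\mathcal X$ with $a_k<b_k$, and an interval $[t_0,t_1]\supseteq\mathcal T$ with $t_0<t_1$. Let $\varphi_\alpha:\mathbb R^n\to\mathbb R$, $\alpha\in\mathbb R^\xi$, be functions with safe sets $\mathcal C_\alpha=\{x:\varphi_\alpha(x)\ge 0\}$ (for instance boxes with edge values $\alpha$), and let $\sigma\in\mathbb R^n$. Let $\mathcal K_1\subset C(\mathcal X;\mathbb R^n)$ be compact in the maximum norm (for instance a compact subset of a Sobolev space that embeds continuously in $C(\mathcal X;\mathbb R^n)$), and let $\mathcal K_2\subset\mathbb R^\xi$ be compact, its elements also being regarded as constant functions on $\mathcal X$. For every $f\in\mathcal K_1$ let a drift on $\mathbb R^n$ that equals $f$ on $\mathcal X$ be given, again denoted $f$. For every initial state $x\in\mathcal X$ let a weak solution of $$dx_t=f(x_t)\,dt+\sigma\,dW_t,\qquad x_0=x$$ be given, where $\sigma$ acts coordinatewise on the standard Wiener process $W_t\in\mathbb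 R^n$. Put $$F_{f,\alpha}(x,t)=\mathbb P\big(x_\tau\in\mathcal C_\alpha\ \ \forall \tau\in[0,t]\ \big|\ x_0=x\big).$$ Assume that $F_{f,\alpha}\in C(\mathcal X\times\mathcal T)$ for all $(f,\alpha)\in\mathcal K_1\times\mathcal K_2$ and that $(f,\alpha)\mapsto F_{f,\alpha}$ is continuous from $\mathcal K_1\times\mathcal K_2$ to $C(\mathcal X\times\mathcal T)$ (maximum norms). **B-splines.** For $\ell>d\ge1$ take the clamped knots $0=\hat x_1=\dots=\hat x_{d+1}\le\dots\le\hat x_{\ell+1}=\dots=\hat x_{\ell+d+1}=1$ with equispaced interior knots. Let $B_{1,d},\dots,B_{\ell,d}$ be the functions given by the Cox–de Boor recursion, with $0/0:=0$ and the last nondegenerate knot interval closed on the right, rescaled from $[0,1]$ to $[a_k,b_k]$ for the coordinate $x_k$ and to $[t_0,t_1]$ for $t$. For a control point tensor $C=(c_{i_1,\dots,i_n,i_t})\in\mathbb R^{\ell_1\times\dots\times\ell_n\times\ell_t}$ put $$C\cdot B_{\ell,d}(x,t)=\sum_{i_1,\dots,i_n,i_t}c_{i_1,\dots,i_n,i_t}\,B_{i_1,d_1}(x_1)\cdots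 B_{i_n,d_n}(x_n)\,B_{i_t,d_t}(t).$$ **Coefficient neural functional.** Let $\rho:\mathbb R\to\mathbb R$ be any continuous activation function that is not a polynomial. A Fourier neural operator applies to the input function $x\mapsto(f(x),\alpha)\in\mathbb R^{n+\xi}$ on $\mathcal X$ a pointwise affine lifting to some width $w$, then at least one Fourier layer $$v\mapsto\rho\Big(Wv(x)+\operatorname{Re}\sum_{k\in\mathbb Z^n,\,|k|_\infty\le N}R_k\,\hat v(k)\,e_k(x)+\beta\Big)$$ ($\rho$ acting coordinatewise, $W\in\mathbb R^{w\times w}$, $R_k\in\mathbb C^{w\times w}$, $\beta\in\mathbb R^w$, $e_k(x)=\exp\big(2\pi i\sum_jk_j\tfrac{x_j-a_j}{b_j-a_j}\big)$, $\hat v(k)=\prod_j(b_j-a_j)^{-1}\int_{\mathcal X}v(y)\overline{e_k(y)}\,dy$, with all parameters specific to the layer), then a pointwise affine projection to $\mathbb R^m$. The coefficient neural functional $G_\theta$ evaluates the output function at finitely many points of $\mathcal X$ and applies an affine layer to these values; the result is the control point tensor $G_\theta(f,\alpha)$. **Theorem (universal approximation for neural spline operators).** For every $\varepsilon>0$ there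 are numbers of control points $\ell_1,\dots,\ell_n,\ell_t$ and orders $d_1,\dots,d_n,d_t\in\mathbb N^+$ with $d_k<\ell_k$ and $d_t<\ell_t$, sizes of the architecture (width, number of modes, number of layers, channels and evaluation points), and parameters $\theta$, such that for all $f\in\mathcal K_1$, $\alpha\in\mathcal K_2$, $x\in\mathcal X$ and $t\in\mathcal T$, $$\big|F_{f,\alpha}(x,t)-G_\theta(f,\alpha)\cdot B_{\ell,d}(x,t)\big|\le\varepsilon .$$ -/

import Mathlib

open MeasureTheory ProbabilityTheory
open scoped NNReal

noncomputable section

/-- `ℝⁿ` with the Euclidean norm. -/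
abbrev Vec (n : ℕ) : Type := EuclideanSpace ℝ (Fin n)

/-! ### The stochastic dynamics and the safety probability -/

/-- `W` is a standard Wiener process in `ℝⁿ` relative to the filtration `𝓕`: its coordinates are
independent standard real Brownian motions, it is adapted, and its increments after time `s` are
independent of `𝓕 s`. -/
structure IsWienerProcess {n : ℕ} {Ω : Type*} {m : MeasurableSpace Ω} (P : Measure Ω)
    (𝓕 : Filtration ℝ≥0 m) (W : ℝ≥0 → Ω → Vec n) : Prop where
  brownian : ∀ k : Fin n, IsBrownianReal (fun t ω => W t ω k) P
  indep_coord : iIndepFun (fun (k : Fin n) ω (t : ℝ≥0) => W t ω k) P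
  adapted : Adapted 𝓕 W
  indep_incr : ∀ s t : ℝ≥0, s ≤ t →
    Indep (MeasurableSpace.comap (fun ω => W t ω - W s ω) inferInstance) (𝓕 s) P

/-- A weak solution of `dx_t = drift (x_t) dt + σ dW_t`, `x_0 = x₀`: a filtered probability space
with a Wiener process `W` and a continuous adapted process `x` satisfying the integrated equation.
The vector `σ` of noise magnitudes acts coordinatewise on `W`. -/
structure WeakSolution {n : ℕ} (drift : Vec n → Vec n) (σ x₀ : Vec n) where
  Ω : Type*
  mΩ : MeasurableSpace Ω
  P : Measure Ω
  isProb : IsProbabilityMeasure P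
  𝓕 : Filtration ℝ≥0 mΩ
  W : ℝ≥0 → Ω → Vec n
  isWiener : IsWienerProcess P 𝓕 W
  x : ℝ≥0 → Ω → Vec n
  adapted : Adapted 𝓕 x
  continuous_paths : ∀ᵐ ω ∂P, Continuous fun t => x t ω
  equation : ∀ᵐ ω ∂P, ∀ (t : ℝ≥0) (k : Fin n),
    IntervalIntegrable (fun s : ℝ => drift (x s.toNNReal ω) k) volume 0 t ∧
    x t ω k = x₀ k + (∫ s in (0 : ℝ)..t, drift (x s.toNNReal ω) k) + σ k * W t ω k

/-- The safe set `{x | φ_α(x) ≥ 0}`. -/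
def safeSet {n ξ : ℕ} (φ : Vec ξ → Vec n → ℝ) (α : Vec ξ) : Set (Vec n) := {x | 0 ≤ φ α x}

/-- `ℙ(x_τ ∈ C for all τ ∈ [0, t] ∣ x_0 = x₀)`. -/
def safetyProbability {n : ℕ} {drift : Vec n → Vec n} {σ x₀ : Vec n}
    (S : WeakSolution drift σ x₀) (C : Set (Vec n)) (t : ℝ) : ℝ :=
  (@Measure.real S.Ω S.mΩ S.P {ω | ∀ τ : ℝ≥0, (τ : ℝ) ≤ t → S.x τ ω ∈ C})

/-! ### B-splines -/

/-- The clamped equispaced knot vector on `[0, 1]` for `ℓ` control points and order `d`, indexed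
from `0` to `ℓ + d`: the first `d + 1` knots are `0`, the last `d + 1` knots are `1`. -/
def knot (ℓ d i : ℕ) : ℝ :=
  if i ≤ d then 0 else if ℓ ≤ i then 1 else ((i : ℝ) - d) / ((ℓ : ℝ) - d)

/-- The Cox–de Boor recursion on the knots `u`. The quotients `0 / 0` that occur at repeated knots
are `0`, and the last nondegenerate knot interval is closed on the right, so that the basis is also
correct at the right end point `1` of the domain. -/
def coxDeBoor (u : ℕ → ℝ) : ℕ → ℕ → ℝ → ℝ
  | 0, i, s =>
      open Classical in
      if (u i ≤ s ∧ s < u (i + 1)) ∨ (s = 1 ∧ u i < 1 ∧ u (i + 1) = 1) then 1 else 0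
  | p + 1, i, s =>
      (s - u i) / (u (i + (p + 1)) - u i) * coxDeBoor u p i s
        + (u (i + (p + 1) + 1) - s) / (u (i + (p + 1) + 1) - u (i + 1)) * coxDeBoor u p (i + 1) s

/-- The `i`-th of the `ℓ` B-spline basis functions of order `d` (indices start at `0`), rescaled
from `[0, 1]` to the interval `[a, b]`. -/
def bspline (ℓ d : ℕ) (a b : ℝ) (i : Fin ℓ) (s : ℝ) : ℝ :=
  coxDeBoor (knot ℓ d) d i ((s - a) / (b - a))

/-- The multi-indices `(i_1, …, i_n, i_t)` of a control point tensor. -/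
abbrev ControlIndex {n : ℕ} (ℓ : Fin n → ℕ) (ℓt : ℕ) : Type :=
  ((k : Fin n) → Fin (ℓ k)) × Fin ℓt

/-- `C · B_{ℓ,d}(x, t)`, the tensor-product B-spline with control points `C`, on the box
`∏ₖ [a_k, b_k] × [t₀, t₁]`. -/
def tensorSpline {n : ℕ} (ℓ d : Fin n → ℕ) (ℓt dt : ℕ) (a b : Vec n) (t₀ t₁ : ℝ)
    (C : ControlIndex ℓ ℓt → ℝ) (x : Vec n) (t : ℝ) : ℝ :=
  ∑ i : ControlIndex ℓ ℓt,
    C i * (∏ k, bspline (ℓ k) (d k) (a k) (b k) (i.1 k) (x k)) * bspline ℓt dt t₀ t₁ i.2 t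

/-! ### Fourier neural operators and the coefficient neural functional -/

/-- The frequencies `k ∈ ℤⁿ` with `|k_j| ≤ N` for all `j`. -/
abbrev Modes (n N : ℕ) : Type := Fin n → Set.Icc (-(N : ℤ)) (N : ℤ)

/-- The Fourier mode `e_k` with the periods of the box `∏ⱼ [a_j, b_j]`. -/
def fourierMode {n N : ℕ} (a b : Vec n) (k : Modes n N) (x : Vec n) : ℂ :=
  Complex.exp (2 * Real.pi * Complex.I *
    ((∑ j, ((k j : ℤ) : ℝ) * ((x j - a j) / (b j - a j)) : ℝ) : ℂ))

/-- The `k`-th Fourier coefficient on the box of a function given on `X` (extended by zero). -/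
def fourierCoefficient {n N : ℕ} (X : Set (Vec n)) (a b : Vec n) (k : Modes n N) (v : X → ℝ) : ℂ :=
  ((∏ j, (b j - a j) : ℝ) : ℂ)⁻¹ *
    ∫ y : X, (v y : ℂ) * (starRingEnd ℂ) (fourierMode a b k (y : Vec n))
      ∂(Measure.comap Subtype.val volume)

/-- The trainable parameters of one Fourier layer of width `w` with `N` modes per dimension:
local weights, spectral weights and bias. -/
structure FourierLayer (n N w : ℕ) where
  weight : Matrix (Fin w) (Fin w) ℝ
  spectral : Modes n N → Matrix (Fin w) (Fin w) ℂ
  bias : Fin w → ℝ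

/-- `v ↦ act (weight v + 𝓡 v + bias)`, where
`𝓡 v (x) = Re ∑ₖ spectral_k v̂(k) e_k(x) = ∫_X κ(x - y) v(y) dy`
is the integral operator whose kernel `κ` is a trigonometric polynomial. -/
def FourierLayer.apply {n N w : ℕ} (L : FourierLayer n N w) (act : ℝ → ℝ) (X : Set (Vec n))
    (a b : Vec n) (v : X → Fin w → ℝ) : X → Fin w → ℝ := fun x i =>
  act (∑ j, L.weight i j * v x j
    + (∑ k : Modes n N, ∑ j, L.spectral k i j * fourierCoefficient X a b k (fun y => v y j)
        * fourierMode a b k (x : Vec n)).re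
    + L.bias i)

/-- The parameters of a Fourier neural operator from `ℝᵖ`-valued to `ℝᵐ`-valued functions, of
width `w`, with `N` modes per dimension and `D + 1` Fourier layers, between an affine pointwise
lifting and an affine pointwise projection. -/
structure FNO (n p m w N D : ℕ) where
  lift : Matrix (Fin w) (Fin p) ℝ
  liftBias : Fin w → ℝ
  layers : Fin (D + 1) → FourierLayer n N w
  proj : Matrix (Fin m) (Fin w) ℝ
  projBias : Fin m → ℝ

/-- The neural operator with the given parameters, applied to the input function `h`. -/
def FNO.apply {n p m w N D : ℕ} (θ : FNO n p m w N D) (act : ℝ → ℝ) (X : Set (Vec n))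
    (a b : Vec n) (h : X → Fin p → ℝ) : X → Fin m → ℝ :=
  let v₀ : X → Fin w → ℝ := fun x i => ∑ j, θ.lift i j * h x j + θ.liftBias i
  let v := (List.ofFn θ.layers).foldl (fun v L => L.apply act X a b v) v₀
  fun x i => ∑ j, θ.proj i j * v x j + θ.projBias i

/-- The parameters of a coefficient neural functional: a Fourier neural operator, whose
`m`-channel output function is read at `M` sensor points of `X`, followed by a linear (affine)
layer into the tensors indexed by `ι`. -/
structure CoefficientFunctional {n : ℕ} (X : Set (Vec n)) (ι : Type) (ξ m w N D M : ℕ) where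
  fno : FNO n (n + ξ) m w N D
  sensor : Fin M → X
  weight : ι → Fin M → Fin m → ℝ
  bias : ι → ℝ

/-- The control point tensor `G_θ(f, α)`. The parameter `α` enters as a constant function on `X`,
so that the neural operator is applied to `x ↦ (f x, α) ∈ ℝ^{n+ξ}`. -/
def CoefficientFunctional.apply {n : ℕ} {X : Set (Vec n)} {ι : Type} {ξ m w N D M : ℕ}
    (θ : CoefficientFunctional X ι ξ m w N D M) (act : ℝ → ℝ) (a b : Vec n)
    (f : C(X, Vec n)) (α : Vec ξ) : ι → ℝ := fun i =>
  let h : X → Fin (n + ξ) → ℝ := fun x => Fin.append (fun k => f x k) (fun k => α k)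
  let g := θ.fno.apply act X a b h
  ∑ r, ∑ j, θ.weight i r j * g (θ.sensor r) j + θ.bias i

end

/-! ### Splines of order one -/

/-! Order one suffices. Hat functions are nonnegative, sum to one and live within one mesh width of
their nodes, so a spline value is an average of nearby control points
(`abs_sub_tensorSpline_one_le`). The safety probability `F` is jointly continuous on a compact set
of (f, α, x, t) and extends continuously beyond X × T by Tietze. On a fine mesh its value at (x, t)
is thus within ε/2 of its values at the neighbouring nodes, uniformly in (f, α). There remain
finitely many continuous functions on the compact K₁ × K₂, one per node, to be approximated within
ε/2 (`exists_coefficientFunctional_approx`).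

One Fourier layer read at one point x₀ yields all sums ∑ ωᵣ ρ(λᵣ + βᵣ), where each λᵣ is a
real-linear functional built from values at x₀ and Fourier coefficients. Such functionals separate
inputs: values at x₀ detect α, and Fourier coefficients detect f
(`eq_zero_of_integral_mul_boxCharacter_eq_zero`). The sums are dense
(`ContinuousMap.topologicalClosure_span_ridge_eq_top`): mollifying ρ and differentiating in a
scaling of λ puts every power of λ, hence exp λ, into the closed span. The exponentials span an
algebra, to which Stone–Weierstrass applies. -/

lemma knot_one_zero (N : ℕ) : knot (N + 1) 1 0 = 0 := by simp [knot]

lemma knot_one_succ {N i : ℕ} (hi : i ≤ N) : knot (N + 1) 1 (i + 1) = i / N := by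
  unfold knot
  rcases Nat.eq_zero_or_pos i with rfl | h0
  · simp
  · rw [if_neg (by omega)]
    rcases hi.eq_or_lt with rfl | h1
    · have : (i : ℝ) ≠ 0 := by positivity
      simp [this]
    · rw [if_neg (by omega)]
      push_cast
      ring

lemma knot_one_last (N : ℕ) : knot (N + 1) 1 (N + 2) = 1 := by simp [knot]

lemma knot_one_mono {N i : ℕ} (hi : i ≤ N + 1) :
    knot (N + 1) 1 i ≤ knot (N + 1) 1 (i + 1) := by
  rcases i with _ | i
  · rw [knot_one_zero, knot_one_succ (Nat.zero_le _)]
    simp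
  · rcases (show i ≤ N by omega).eq_or_lt with rfl | h
    · rw [knot_one_succ le_rfl, knot_one_last]
      exact div_self_le_one _
    · rw [knot_one_succ h.le, knot_one_succ h]
      gcongr
      simp

lemma coxDeBoor_zero_nonneg (u : ℕ → ℝ) (i : ℕ) (s : ℝ) : 0 ≤ coxDeBoor u 0 i s := by
  unfold coxDeBoor
  split_ifs <;> norm_num

lemma mem_Icc_of_coxDeBoor_zero_ne_zero {u : ℕ → ℝ} {i : ℕ} {s : ℝ}
    (h : coxDeBoor u 0 i s ≠ 0) : s ∈ Set.Icc (u i) (u (i + 1)) := by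
  unfold coxDeBoor at h
  split_ifs at h with h1
  · rcases h1 with h1 | ⟨rfl, h1, h2⟩
    · exact ⟨h1.1, h1.2.le⟩
    · exact ⟨h1.le, h2.ge⟩
  · exact absurd rfl h

lemma coxDeBoor_one_nonneg {N i : ℕ} (hi : i ≤ N) (s : ℝ) :
    0 ≤ coxDeBoor (knot (N + 1) 1) 1 i s := by
  set u := knot (N + 1) 1
  have h1 : u i ≤ u (i + 1) := knot_one_mono (by omega)
  have h2 : u (i + 1) ≤ u (i + 2) := knot_one_mono (by omega)
  -- The linear factors can be negative, but not on the knot interval of the indicator they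
  -- multiply.
  have key : ∀ j v, (coxDeBoor u 0 j s ≠ 0 → 0 ≤ v) → 0 ≤ v * coxDeBoor u 0 j s := by
    intro j v hv
    by_cases h : coxDeBoor u 0 j s = 0
    · simp [h]
    · exact mul_nonneg (hv h) (coxDeBoor_zero_nonneg _ _ _)
  rw [coxDeBoor]
  refine add_nonneg (key _ _ fun h => ?_) (key _ _ fun h => ?_)
  · exact div_nonneg (sub_nonneg.2 (mem_Icc_of_coxDeBoor_zero_ne_zero h).1) (sub_nonneg.2 h1)
  · exact div_nonneg (sub_nonneg.2 (mem_Icc_of_coxDeBoor_zero_ne_zero h).2) (sub_nonneg.2 h2)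

lemma abs_sub_le_of_coxDeBoor_one_ne_zero {N i : ℕ} (hN : 0 < N) (hi : i ≤ N) {s : ℝ}
    (h : coxDeBoor (knot (N + 1) 1) 1 i s ≠ 0) : |s - i / N| ≤ 1 / N := by
  have hN' : (0 : ℝ) < 1 / N := by positivity
  have hlo : (i : ℝ) / N - 1 / N ≤ knot (N + 1) 1 i := by
    rcases i with _ | i
    · rw [knot_one_zero]; simp
    · rw [knot_one_succ (by omega)]
      push_cast
      rw [add_div]
      linarith
  have hmid : knot (N + 1) 1 (i + 1) = i / N := knot_one_succ hi
  have hhi : knot (N + 1) 1 (i + 2) ≤ (i : ℝ) / N + 1 / N := by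
    rcases hi.eq_or_lt with rfl | h
    · rw [knot_one_last, div_self (by positivity)]
      linarith
    · rw [knot_one_succ (i := i + 1) h]
      push_cast
      rw [add_div]
  have hsupp : coxDeBoor (knot (N + 1) 1) 0 i s ≠ 0 ∨
      coxDeBoor (knot (N + 1) 1) 0 (i + 1) s ≠ 0 := by
    by_contra! hcon
    exact h (by simp [coxDeBoor.eq_2, hcon.1, hcon.2])
  rw [abs_le]
  rcases hsupp with hs | hs
  · obtain ⟨h1, h2⟩ := mem_Icc_of_coxDeBoor_zero_ne_zero hs
    constructor <;> linarith
  · obtain ⟨h1, h2⟩ := mem_Icc_of_coxDeBoor_zero_ne_zero hs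
    have : knot (N + 1) 1 (i + 1 + 1) ≤ (i : ℝ) / N + 1 / N := hhi
    constructor <;> linarith

lemma sum_coxDeBoor_zero {u : ℕ → ℝ} {N : ℕ} (hu : ∀ i < N, u i ≤ u (i + 1)) (h0 : u 0 = 0)
    (h1 : u N = 1) {s : ℝ} (hs : s ∈ Set.Icc (0 : ℝ) 1) :
    ∑ i ∈ Finset.range N, coxDeBoor u 0 i s = 1 := by
  have hmono : ∀ m, m ≤ N → ∀ i, i ≤ m → u i ≤ u m := by
    intro m
    induction m with
    | zero => intro _ i hi; rw [Nat.le_zero.1 hi]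
    | succ m ih =>
      intro hm i hi
      rcases hi.eq_or_lt with rfl | hlt
      · exact le_rfl
      · exact (ih (by omega) i (by omega)).trans (hu m (by omega))
  classical
  rcases hs.2.eq_or_lt with rfl | hlt
  -- Each indicator is a difference of step functions of the knots, so the sum telescopes. At s = 1
  -- the step is at `u i < 1`, which selects the last nondegenerate interval.
  · have key : ∀ i ∈ Finset.range N, coxDeBoor u 0 i 1 =
        (if u (i + 1) < 1 then (0 : ℝ) else 1) - (if u i < 1 then 0 else 1) := by
      intro i hi
      have hi' := Finset.mem_range.1 hi
      have h2 := hu i hi'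
      have h3 : u (i + 1) ≤ 1 := h1 ▸ hmono N le_rfl (i + 1) hi'
      rw [coxDeBoor]
      grind
    rw [Finset.sum_congr rfl key, Finset.sum_range_sub (fun i => if u i < 1 then (0 : ℝ) else 1)]
    simp [h0, h1]
  · have key : ∀ i ∈ Finset.range N, coxDeBoor u 0 i s =
        (if u (i + 1) ≤ s then (0 : ℝ) else 1) - (if u i ≤ s then 0 else 1) := by
      intro i hi
      have h2 := hu i (Finset.mem_range.1 hi)
      rw [coxDeBoor]
      grind
    rw [Finset.sum_congr rfl key, Finset.sum_range_sub (fun i => if u i ≤ s then (0 : ℝ) else 1)]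
    simp [h0, h1, hs.1, hlt]

/-- On each nondegenerate knot interval exactly two hats are active, one rising and one falling, and
their linear factors add up to 1. -/
lemma sum_coxDeBoor_one {N : ℕ} (hN : 0 < N) {s : ℝ} (hs : s ∈ Set.Icc (0 : ℝ) 1) :
    ∑ i ∈ Finset.range (N + 1), coxDeBoor (knot (N + 1) 1) 1 i s = 1 := by
  set u := knot (N + 1) 1 with hu
  have hu0 : u 0 = 0 := knot_one_zero N
  have hu1 : u 1 = 0 := by simp [hu, knot]
  have huN1 : u (N + 1) = 1 := by
    rw [hu, knot_one_succ le_rfl, div_self (by positivity)]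
  have huN2 : u (N + 2) = 1 := knot_one_last N
  -- The knots are shifted by one because the first interval, from `u 0` to `u 1`, is degenerate.
  have hsum := sum_coxDeBoor_zero (u := fun i => u (i + 1)) (N := N)
    (fun i hi => knot_one_mono (by omega)) hu1 huN1 hs
  have hshift : ∀ i, coxDeBoor (fun i => u (i + 1)) 0 i s = coxDeBoor u 0 (i + 1) s := fun i => by
    simp only [coxDeBoor]
  rw [Finset.sum_congr rfl fun i _ => hshift i] at hsum
  simp only [coxDeBoor.eq_2, zero_add]
  -- The terms split off at the two ends belong to repeated knots and vanish as quotients by 0.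
  rw [Finset.sum_add_distrib, Finset.sum_range_succ', Finset.sum_range_succ, hu0, hu1, huN1,
    huN2, ← hsum]
  simp only [sub_self, div_zero, zero_mul, add_zero]
  rw [← Finset.sum_add_distrib]
  refine Finset.sum_congr rfl fun i hi => ?_
  have hlt : u (i + 1) < u (i + 2) := by
    have hi' := Finset.mem_range.1 hi
    rw [hu, knot_one_succ hi'.le, knot_one_succ (i := i + 1) hi']
    gcongr
    exact i.lt_succ_self
  rw [← add_mul, ← add_div]
  have : s - u (i + 1) + (u (i + 1 + 1) - s) = u (i + 1 + 1) - u (i + 1) := by ring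
  rw [this, div_self (sub_pos.2 hlt).ne', one_mul]

section HatFunctions

variable {N : ℕ} {a b : ℝ}

lemma bspline_one_nonneg (i : Fin (N + 1)) (s : ℝ) : 0 ≤ bspline (N + 1) 1 a b i s :=
  coxDeBoor_one_nonneg (by omega) _

lemma sum_bspline_one (hN : 0 < N) (hab : a < b) {s : ℝ} (hs : s ∈ Set.Icc a b) :
    ∑ i : Fin (N + 1), bspline (N + 1) 1 a b i s = 1 := by
  have hba := sub_pos.2 hab
  rw [← sum_coxDeBoor_one hN (s := (s - a) / (b - a)), Finset.sum_range]
  · rfl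
  · exact ⟨div_nonneg (sub_nonneg.2 hs.1) hba.le, (div_le_one hba).2 (by linarith [hs.2])⟩

/-- The node at which the `i`-th of the `N + 1` hat functions on `[a, b]` attains its maximum. -/
noncomputable def hatNode (N : ℕ) (a b : ℝ) (i : Fin (N + 1)) : ℝ := a + (b - a) * (i / N)

lemma hatNode_mem_Icc (hab : a < b) (i : Fin (N + 1)) :
    hatNode N a b i ∈ Set.Icc a b := by
  have hba := sub_pos.2 hab
  have h1 : ((i : ℕ) : ℝ) / N ≤ 1 :=
    div_le_one_of_le₀ (by exact_mod_cast Nat.lt_succ_iff.1 i.2) (by positivity)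
  have h0 : (0 : ℝ) ≤ ((i : ℕ) : ℝ) / N := by positivity
  unfold hatNode
  constructor <;> nlinarith

lemma abs_sub_hatNode_le (hN : 0 < N) (hab : a < b) {i : Fin (N + 1)} {s : ℝ}
    (h : bspline (N + 1) 1 a b i s ≠ 0) : |s - hatNode N a b i| ≤ (b - a) / N := by
  have hba := sub_pos.2 hab
  have h1 := abs_sub_le_of_coxDeBoor_one_ne_zero hN (by omega) h
  have h2 : s - hatNode N a b i = (b - a) * ((s - a) / (b - a) - (i : ℕ) / N) := by
    unfold hatNode
    field_simp
    ring
  rw [h2, abs_mul, abs_of_pos hba]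
  calc (b - a) * |(s - a) / (b - a) - (i : ℕ) / N| ≤ (b - a) * (1 / N) := by gcongr
    _ = (b - a) / N := by ring

end HatFunctions

/-- The weight of a control point in the tensor-product spline of order one. -/
noncomputable def hatWeight {n : ℕ} (N : ℕ) (a b : Vec n) (t₀ t₁ : ℝ)
    (i : ControlIndex (fun _ : Fin n => N + 1) (N + 1)) (x : Vec n) (t : ℝ) : ℝ :=
  (∏ k, bspline (N + 1) 1 (a k) (b k) (i.1 k) (x k)) * bspline (N + 1) 1 t₀ t₁ i.2 t

section HatWeight

variable {n N : ℕ} {a b : Vec n} {t₀ t₁ : ℝ}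

lemma tensorSpline_one (C : ControlIndex (fun _ : Fin n => N + 1) (N + 1) → ℝ)
    (x : Vec n) (t : ℝ) :
    tensorSpline (fun _ => N + 1) (fun _ => 1) (N + 1) 1 a b t₀ t₁ C x t =
      ∑ i, hatWeight N a b t₀ t₁ i x t * C i :=
  Finset.sum_congr rfl fun i _ => by rw [hatWeight]; ring

lemma hatWeight_nonneg (i : ControlIndex (fun _ : Fin n => N + 1) (N + 1)) (x : Vec n) (t : ℝ) :
    0 ≤ hatWeight N a b t₀ t₁ i x t :=
  mul_nonneg (Finset.prod_nonneg fun _ _ => bspline_one_nonneg _ _) (bspline_one_nonneg _ _)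

lemma sum_hatWeight (hN : 0 < N) (hab : ∀ k, a k < b k) (ht : t₀ < t₁) {x : Vec n} {t : ℝ}
    (hx : ∀ k, x k ∈ Set.Icc (a k) (b k)) (htt : t ∈ Set.Icc t₀ t₁) :
    ∑ i, hatWeight N a b t₀ t₁ i x t = 1 := by
  unfold hatWeight
  rw [Fintype.sum_prod_type]
  simp only [← Finset.mul_sum, sum_bspline_one hN ht htt, mul_one]
  rw [← Fintype.prod_sum fun k j => bspline (N + 1) 1 (a k) (b k) j (x k)]
  exact Finset.prod_eq_one fun k _ => sum_bspline_one hN (hab k) (hx k)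

/-- A product is nonzero only if every factor is, so each coordinate is within one mesh width. The
type `Fin n → ℝ` supplies the maximum metric, which avoids dimensional constants. -/
lemma dist_hatNode_le (hN : 0 < N) (hab : ∀ k, a k < b k) (ht : t₀ < t₁) {x : Vec n} {t : ℝ}
    {i : ControlIndex (fun _ : Fin n => N + 1) (N + 1)} (h : hatWeight N a b t₀ t₁ i x t ≠ 0)
    {δ : ℝ} (hδ : 0 ≤ δ) (hδx : ∀ k, (b k - a k) / N ≤ δ) (hδt : (t₁ - t₀) / N ≤ δ) :
    dist ((fun k => x k, t) : (Fin n → ℝ) × ℝ)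
      (fun k => hatNode N (a k) (b k) (i.1 k), hatNode N t₀ t₁ i.2) ≤ δ := by
  rw [Prod.dist_eq, max_le_iff, dist_pi_le_iff hδ]
  refine ⟨fun k => ?_, ?_⟩
  · exact (abs_sub_hatNode_le hN (hab k)
      (Finset.prod_ne_zero_iff.1 (left_ne_zero_of_mul h) k (Finset.mem_univ _))).trans (hδx k)
  · exact (abs_sub_hatNode_le hN ht (right_ne_zero_of_mul h)).trans hδt

/-- If all control points whose basis functions do not vanish at `(x, t)` are `η`-close to `y`,
then so is the value of the spline at `(x, t)`. -/
lemma abs_sub_tensorSpline_one_le (hN : 0 < N) (hab : ∀ k, a k < b k) (ht : t₀ < t₁) {x : Vec n}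
    {t : ℝ} (hx : ∀ k, x k ∈ Set.Icc (a k) (b k)) (htt : t ∈ Set.Icc t₀ t₁) {η y : ℝ}
    (C : ControlIndex (fun _ : Fin n => N + 1) (N + 1) → ℝ)
    (hC : ∀ i, hatWeight N a b t₀ t₁ i x t ≠ 0 → |y - C i| ≤ η) :
    |y - tensorSpline (fun _ => N + 1) (fun _ => 1) (N + 1) 1 a b t₀ t₁ C x t| ≤ η := by
  -- By the partition of unity, the error is the weighted average of the errors `y - C i`.
  have hsum := sum_hatWeight hN hab ht hx htt
  have h1 : y - tensorSpline (fun _ => N + 1) (fun _ => 1) (N + 1) 1 a b t₀ t₁ C x t =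
      ∑ i, hatWeight N a b t₀ t₁ i x t * (y - C i) := by
    simp only [mul_sub, Finset.sum_sub_distrib, ← Finset.sum_mul, hsum, one_mul, tensorSpline_one]
  have h2 : η = ∑ i, hatWeight N a b t₀ t₁ i x t * η := by rw [← Finset.sum_mul, hsum, one_mul]
  rw [h1, h2]
  refine (Finset.abs_sum_le_sum_abs _ _).trans (Finset.sum_le_sum fun i _ => ?_)
  rw [abs_mul, abs_of_nonneg (hatWeight_nonneg _ _ _)]
  by_cases h : hatWeight N a b t₀ t₁ i x t = 0
  · simp [h]
  · exact mul_le_mul_of_nonneg_left (hC i h) (hatWeight_nonneg _ _ _)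

end HatWeight

/-! ### Density of ridge functions with a non-polynomial activation -/

section RidgeDensity

open scoped Topology Convolution ContDiff
open Filter

variable {K : Type*} [TopologicalSpace K] [CompactSpace K]

/-- A closed subspace is complete, so the integral can be formed inside it and commutes with the
inclusion. -/
lemma Submodule.integral_mem_of_hasCompactSupport {E : Type*} [NormedAddCommGroup E]
    [NormedSpace ℝ E] [CompleteSpace E] {S : Submodule ℝ E} (hS : IsClosed (S : Set E))
    {f : ℝ → E} (hf : Continuous f) (hfc : HasCompactSupport f) (hfS : ∀ y, f y ∈ S) :
    ∫ y, f y ∈ S := by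
  have : CompleteSpace S := hS.completeSpace_coe
  let g : ℝ → S := fun y => ⟨f y, hfS y⟩
  have hg : Continuous g := hf.subtype_mk _
  have hgc : HasCompactSupport g := by
    refine hfc.mono fun y hy => ?_
    contrapose! hy
    simpa [g, Subtype.ext_iff] using hy
  have := S.subtypeL.integral_comp_comm (hg.integrable_of_hasCompactSupport hgc (μ := volume))
  have h2 : ∫ y, f y = S.subtypeL (∫ y, g y) := this
  rw [h2]
  exact (∫ y, g y).2

/-- Mollification superposes translates of `ρ`, so `ψ.comp g` is a `C(K, ℝ)`-valued integral of
elements of `S`. This replaces `ρ` by a smooth function without leaving `S`. -/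
lemma ContinuousMap.comp_convolution_mem {S : Submodule ℝ C(K, ℝ)}
    (hS : IsClosed (S : Set C(K, ℝ))) (ρ : C(ℝ, ℝ)) {w : ℝ → ℝ} (hw : Continuous w)
    (hwc : HasCompactSupport w) (ψ : C(ℝ, ℝ))
    (hψ : ∀ u, ψ u = (w ⋆[ContinuousLinearMap.lsmul ℝ ℝ, volume] ρ) u) (g : C(K, ℝ))
    (h : ∀ b : ℝ, ρ.comp (g + ContinuousMap.const K b) ∈ S) : ψ.comp g ∈ S := by
  let f : ℝ → C(K, ℝ) := fun y => w y • ρ.comp (g + ContinuousMap.const K (-y))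
  have hf : Continuous f := by
    refine hw.smul ((ContinuousMap.continuous_postcomp ρ).comp ?_)
    exact continuous_const.add (ContinuousMap.continuous_const'.comp continuous_neg)
  have hfc : HasCompactSupport f := hwc.smul_right
  have hmem := Submodule.integral_mem_of_hasCompactSupport hS hf hfc
    fun y => S.smul_mem _ (h (-y))
  convert hmem using 1
  ext x
  have := (ContinuousMap.evalCLM ℝ x).integral_comp_comm
    (hf.integrable_of_hasCompactSupport hfc (μ := volume))
  rw [ContinuousMap.comp_apply, hψ, convolution_def]
  refine Eq.trans ?_ this
  simp [f, sub_eq_add_neg]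

/-- The pointwise derivative is also one in the maximum norm: the curve is the integral of a
continuous `C(K, ℝ)`-valued function. -/
lemma ContinuousMap.hasDerivAt_comp_line (χ χ' : C(ℝ, ℝ)) (hχ : ∀ u, HasDerivAt χ (χ' u) u)
    (g c : C(K, ℝ)) (a : ℝ) :
    HasDerivAt (fun a : ℝ => χ.comp (a • g + c)) (g * χ'.comp (a • g + c)) a := by
  let Q : ℝ → C(K, ℝ) := fun τ => g * χ'.comp (τ • g + c)
  have hQ : Continuous Q := by
    refine continuous_const.mul ((ContinuousMap.continuous_postcomp χ').comp ?_)
    fun_prop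
  have hP : (fun a : ℝ => χ.comp (a • g + c)) =
      fun a => χ.comp c + ∫ τ in (0 : ℝ)..a, Q τ := by
    ext a x
    have h1 := (ContinuousMap.evalCLM ℝ x).intervalIntegral_comp_comm
      (hQ.intervalIntegrable (μ := volume) 0 a)
    have h2 : ∫ τ in (0 : ℝ)..a, g x * χ' (τ * g x + c x) =
        χ (a * g x + c x) - χ (0 * g x + c x) := by
      refine intervalIntegral.integral_eq_sub_of_hasDerivAt
        (f := fun τ => χ (τ * g x + c x)) (fun τ _ => ?_) ?_
      · have := (hχ (τ * g x + c x)).comp τ (((hasDerivAt_id τ).mul_const (g x)).add_const (c x))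
        simpa [mul_comm, Function.comp_def] using this
      · exact Continuous.intervalIntegrable (by fun_prop) _ _
    have h3 : (∫ τ in (0 : ℝ)..a, Q τ) x = ∫ τ in (0 : ℝ)..a, g x * χ' (τ * g x + c x) :=
      h1.symm
    simp [h3, h2]
  rw [hP]
  exact (intervalIntegral.integral_hasDerivAt_right (hQ.intervalIntegrable _ _)
    (hQ.stronglyMeasurableAtFilter _ _) hQ.continuousAt).const_add _

lemma Submodule.hasDerivAt_mem {E : Type*} [NormedAddCommGroup E] [NormedSpace ℝ E]
    {S : Submodule ℝ E} (hS : IsClosed (S : Set E)) {f : ℝ → E} {f' : E} {a : ℝ}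
    (hf : HasDerivAt f f' a) (hfS : ∀ t, f t ∈ S) : f' ∈ S := by
  refine hS.mem_of_tendsto hf.tendsto_slope (Eventually.of_forall fun t => ?_)
  rw [slope_def_module]
  exact S.smul_mem _ (S.sub_mem (hfS _) (hfS _))

/-- Each derivative in `a` brings down a factor `g` and stays in `S`, being a limit of difference
quotients. -/
lemma ContinuousMap.pow_mul_iteratedDeriv_comp_mem {S : Submodule ℝ C(K, ℝ)}
    (hS : IsClosed (S : Set C(K, ℝ))) {ψ : ℝ → ℝ} (hψ : ContDiff ℝ ∞ ψ) (g c : C(K, ℝ))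
    (h : ∀ a : ℝ, (⟨ψ, hψ.continuous⟩ : C(ℝ, ℝ)).comp (a • g + c) ∈ S) (k : ℕ) (a : ℝ) :
    g ^ k * (⟨iteratedDeriv k ψ, hψ.continuous_iteratedDeriv k (mod_cast le_top)⟩ : C(ℝ, ℝ)).comp
      (a • g + c) ∈ S := by
  induction k generalizing a with
  | zero => simpa using h a
  | succ k ih =>
    have hd := ContinuousMap.hasDerivAt_comp_line
      ⟨iteratedDeriv k ψ, hψ.continuous_iteratedDeriv k (mod_cast le_top)⟩
      ⟨iteratedDeriv (k + 1) ψ, hψ.continuous_iteratedDeriv (k + 1) (mod_cast le_top)⟩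
      (fun u => by
        rw [ContinuousMap.coe_mk, ContinuousMap.coe_mk, iteratedDeriv_succ]
        exact ((hψ.differentiable_iteratedDeriv k (mod_cast ENat.natCast_lt_top k)) u).hasDerivAt) g c a
    have := Submodule.hasDerivAt_mem hS (hd.const_mul (g ^ k)) ih
    rwa [← mul_assoc, ← pow_succ] at this

lemma exists_polynomial_of_iteratedDeriv_eq_zero {ψ : ℝ → ℝ} (hψ : ContDiff ℝ ∞ ψ) {k : ℕ}
    (h : ∀ u, iteratedDeriv k ψ u = 0) :
    ∃ p : Polynomial ℝ, p.degree < k ∧ ∀ u, ψ u = p.eval u := by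
  rcases k with _ | k
  · exact ⟨0, by simp, fun u => by simpa using h u⟩
  refine ⟨∑ j ∈ Finset.range (k + 1),
    Polynomial.C (iteratedDeriv j ψ 0 / j.factorial) * Polynomial.X ^ j, ?_, fun u => ?_⟩
  · refine (Polynomial.degree_sum_le _ _).trans_lt ?_
    rw [Finset.sup_lt_iff (by exact_mod_cast WithBot.bot_lt_coe _)]
    intro j hj
    exact (Polynomial.degree_C_mul_X_pow_le _ _).trans_lt
      (by exact_mod_cast Finset.mem_range.1 hj)
  rw [Polynomial.eval_finsetSum]
  rcases eq_or_ne 0 u with rfl | hu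
  · rw [Finset.sum_eq_single 0] <;> simp +contextual
  · obtain ⟨x', -, hx'⟩ := taylor_mean_remainder_lagrange_iteratedDeriv (f := ψ) (n := k) hu
      ((hψ.of_le (mod_cast le_top)).contDiffOn)
    rw [h, zero_mul, zero_div, sub_eq_zero, taylor_within_apply] at hx'
    rw [hx']
    refine Finset.sum_congr rfl fun j _ => ?_
    have huniq : UniqueDiffOn ℝ (Set.uIcc 0 u) := uniqueDiffOn_Icc (by simpa using hu.symm)
    rw [iteratedDerivWithin_eq_iteratedDeriv huniq
      ((hψ.of_le (mod_cast le_top)).contDiffAt) Set.left_mem_uIcc]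
    simp
    ring

/-- The uniform degree bound is essential: such polynomials are interpolated from their values at
`k` fixed points, and these values converge. -/
lemma exists_polynomial_of_tendsto {ρ : ℝ → ℝ} {ψ : ℕ → ℝ → ℝ} {k : ℕ}
    (hψ : ∀ m, ∃ p : Polynomial ℝ, p.degree < k ∧ ∀ u, ψ m u = p.eval u)
    (h : ∀ u, Tendsto (fun m => ψ m u) atTop (𝓝 (ρ u))) :
    ∃ p : Polynomial ℝ, ∀ u, ρ u = p.eval u := by
  let v : ℕ → ℝ := fun i => i
  have hv : Set.InjOn v (Finset.range k) := fun i _ j _ hij => by simpa [v] using hij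
  have hint : ∀ (r : ℕ → ℝ) (u : ℝ), (Lagrange.interpolate (Finset.range k) v r).eval u =
      ∑ i ∈ Finset.range k, r i * (Lagrange.basis (Finset.range k) v i).eval u := by
    intro r u
    simp [Lagrange.interpolate_apply, Polynomial.eval_finsetSum]
  refine ⟨Lagrange.interpolate (Finset.range k) v fun i => ρ (v i), fun u => ?_⟩
  refine tendsto_nhds_unique (h u) ?_
  rw [hint]
  have : (fun m => ψ m u) = fun m => ∑ i ∈ Finset.range k,
      ψ m (v i) * (Lagrange.basis (Finset.range k) v i).eval u := by
    ext m
    obtain ⟨p, hp, hpu⟩ := hψ m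
    rw [← hint, ← Lagrange.eq_interpolate_of_eval_eq (f := p) _ hv (by simpa using hp)
      fun i _ => (hpu _).symm, hpu]
  rw [this]
  exact tendsto_finsetSum _ fun i _ => (h _).mul_const _

lemma contDiff_normed_convolution (w : ContDiffBump (0 : ℝ)) {ρ : ℝ → ℝ} (hρ : Continuous ρ) :
    ContDiff ℝ ∞ (w.normed volume ⋆[ContinuousLinearMap.lsmul ℝ ℝ, volume] ρ) :=
  w.hasCompactSupport_normed.contDiff_convolution_left _ w.contDiff_normed hρ.locallyIntegrable

/-- Otherwise all mollifications would be polynomials of degree below `k`, and so would be their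
pointwise limit `ρ`. -/
lemma exists_iteratedDeriv_convolution_ne_zero {ρ : ℝ → ℝ} (hρ : Continuous ρ)
    (hpoly : ¬ ∃ p : Polynomial ℝ, ∀ s, ρ s = p.eval s) (k : ℕ) :
    ∃ (w : ContDiffBump (0 : ℝ)) (b : ℝ), iteratedDeriv k
      (w.normed volume ⋆[ContinuousLinearMap.lsmul ℝ ℝ, volume] ρ) b ≠ 0 := by
  by_contra! hcon
  apply hpoly
  let w : ℕ → ContDiffBump (0 : ℝ) := fun m =>
    ⟨1 / (2 * (m + 1)), 1 / (m + 1), by positivity, by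
      gcongr
      linarith [(m.cast_nonneg : (0 : ℝ) ≤ m)]⟩
  refine exists_polynomial_of_tendsto (k := k)
    (ψ := fun m => (w m).normed volume ⋆[ContinuousLinearMap.lsmul ℝ ℝ, volume] ρ)
    (fun m => exists_polynomial_of_iteratedDeriv_eq_zero
      (contDiff_normed_convolution _ hρ) (hcon _)) fun u => ?_
  exact ContDiffBump.convolution_tendsto_right_of_continuous
    tendsto_one_div_add_atTop_nhds_zero_nat hρ u

/-- For the mollification ψ, the `k`-th derivative of ψ(a g + b) at a = 0 is `g ^ k` times the
constant ψ⁽ᵏ⁾(b), and `b` is chosen to make this nonzero. -/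
lemma ContinuousMap.pow_mem_of_ridge_mem {S : Submodule ℝ C(K, ℝ)}
    (hS : IsClosed (S : Set C(K, ℝ))) (ρ : C(ℝ, ℝ))
    (hpoly : ¬ ∃ p : Polynomial ℝ, ∀ s, ρ s = p.eval s) (g : C(K, ℝ))
    (h : ∀ a b : ℝ, ρ.comp (a • g + ContinuousMap.const K b) ∈ S) (k : ℕ) : g ^ k ∈ S := by
  obtain ⟨w, b, hb⟩ := exists_iteratedDeriv_convolution_ne_zero ρ.continuous hpoly k
  have hψ := contDiff_normed_convolution w ρ.continuous
  have hmem := ContinuousMap.pow_mul_iteratedDeriv_comp_mem hS hψ g (ContinuousMap.const K b)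
    (fun a => ContinuousMap.comp_convolution_mem hS ρ w.continuous_normed
      w.hasCompactSupport_normed _ (fun _ => rfl) _ fun b' => by
        convert h a (b + b') using 2
        ext x
        simp [add_assoc]) k 0
  refine (S.smul_mem_iff hb).1 ?_
  convert hmem using 1
  ext x
  simp [mul_comm]

/-- Ridge functions `x ↦ ρ (g x + b)`, where `g` ranges over a space of continuous functions that
separates points and `ρ` is not a polynomial, have a dense span. -/
theorem ContinuousMap.topologicalClosure_span_ridge_eq_top (V : Submodule ℝ C(K, ℝ))
    (hV : ∀ x y : K, x ≠ y → ∃ g ∈ V, g x ≠ g y) (ρ : C(ℝ, ℝ))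
    (hpoly : ¬ ∃ p : Polynomial ℝ, ∀ s, ρ s = p.eval s) :
    (Submodule.span ℝ {f : C(K, ℝ) | ∃ g ∈ V, ∃ b : ℝ,
      f = ρ.comp (g + ContinuousMap.const K b)}).topologicalClosure = ⊤ := by
  set S := (Submodule.span ℝ {f : C(K, ℝ) | ∃ g ∈ V, ∃ b : ℝ,
      f = ρ.comp (g + ContinuousMap.const K b)}).topologicalClosure with hSdef
  have hS : IsClosed (S : Set C(K, ℝ)) := Submodule.isClosed_topologicalClosure _
  have hexp : ∀ g ∈ V, NormedSpace.exp g ∈ S := by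
    intro g hg
    refine hS.mem_of_tendsto (NormedSpace.exp_series_hasSum_exp' (𝕂 := ℝ) g)
      (Eventually.of_forall fun s => S.sum_mem fun k _ => S.smul_mem _ ?_)
    refine ContinuousMap.pow_mem_of_ridge_mem hS ρ hpoly g (fun a b => ?_) k
    exact Submodule.le_topologicalClosure _
      (Submodule.subset_span ⟨a • g, V.smul_mem _ hg, b, rfl⟩)
  have hadd : ∀ g₁ g₂ : C(K, ℝ), NormedSpace.exp (g₁ + g₂) =
      NormedSpace.exp g₁ * NormedSpace.exp g₂ := fun g₁ g₂ => NormedSpace.exp_add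
  -- Since `V` is closed under addition, its exponentials are closed under products, so their span
  -- is already an algebra and lies in `S`.
  let M : Submonoid C(K, ℝ) :=
    { carrier := {f | ∃ g ∈ V, f = NormedSpace.exp g}
      one_mem' := ⟨0, V.zero_mem, by simp⟩
      mul_mem' := by
        rintro _ _ ⟨g₁, h₁, rfl⟩ ⟨g₂, h₂, rfl⟩
        exact ⟨g₁ + g₂, V.add_mem h₁ h₂, (hadd _ _).symm⟩ }
  let A : Subalgebra ℝ C(K, ℝ) := Algebra.adjoin ℝ (M : Set C(K, ℝ))
  have hAS : (A : Set C(K, ℝ)) ⊆ S := by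
    intro f hf
    have hf' : f ∈ Subalgebra.toSubmodule A := hf
    rw [Algebra.adjoin_eq_span, Submonoid.closure_eq] at hf'
    refine (Submodule.span_le.2 ?_ : _ ≤ S) hf'
    rintro _ ⟨g, hg, rfl⟩
    exact hexp g hg
  have hsep : A.SeparatesPoints := by
    intro x y hxy
    obtain ⟨g, hg, hgxy⟩ := hV x y hxy
    refine ⟨_, ⟨NormedSpace.exp g, Algebra.subset_adjoin ⟨g, hg, rfl⟩, rfl⟩, ?_⟩
    dsimp only
    have hev : ∀ z : K, NormedSpace.exp g z = Real.exp (g z) := fun z => by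
      have := NormedSpace.map_exp (ContinuousMap.evalAlgHom ℝ ℝ z) (continuous_eval_const z) g
      rw [Real.exp_eq_exp_ℝ]
      exact this
    rw [hev, hev]
    exact fun h => hgxy (Real.exp_injective h)
  have htop := ContinuousMap.subalgebra_topologicalClosure_eq_top_of_separatesPoints A hsep
  rw [eq_top_iff]
  intro f _
  have : f ∈ A.topologicalClosure := by rw [htop]; trivial
  exact closure_minimal hAS hS this

end RidgeDensity

/-! ### Fourier coefficients separate points -/

section FourierSeparation

open scoped Topology
open Filter

variable {n : ℕ}

/-- The character of the box with integer frequency vector `k`. -/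
noncomputable def boxCharacter (a b : Vec n) (k : Fin n → ℤ) (x : Vec n) : ℂ :=
  Complex.exp (2 * Real.pi * Complex.I *
    ((∑ j, (k j : ℝ) * ((x j - a j) / (b j - a j)) : ℝ) : ℂ))

lemma continuous_boxCharacter (a b : Vec n) (k : Fin n → ℤ) : Continuous (boxCharacter a b k) := by
  unfold boxCharacter
  fun_prop

lemma boxCharacter_zero (a b x : Vec n) : boxCharacter a b 0 x = 1 := by simp [boxCharacter]

lemma boxCharacter_add (a b : Vec n) (k l : Fin n → ℤ) (x : Vec n) :
    boxCharacter a b (k + l) x = boxCharacter a b k x * boxCharacter a b l x := by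
  simp only [boxCharacter, ← Complex.exp_add, ← mul_add, ← Complex.ofReal_add, Pi.add_apply,
    Int.cast_add, add_mul, Finset.sum_add_distrib]

lemma conj_boxCharacter (a b : Vec n) (k : Fin n → ℤ) (x : Vec n) :
    (starRingEnd ℂ) (boxCharacter a b k x) = boxCharacter a b (-k) x := by
  simp only [boxCharacter, ← Complex.exp_conj]
  simp [Complex.conj_ofNat]

lemma boxCharacter_single (a b : Vec n) (j : Fin n) (m : ℤ) (x : Vec n) :
    boxCharacter a b (Pi.single j m) x =
      Complex.exp (2 * Real.pi * Complex.I * ((m * ((x j - a j) / (b j - a j)) : ℝ) : ℂ)) := by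
  unfold boxCharacter
  congr 3
  rw [Finset.sum_eq_single j] <;> simp +contextual

/-- The trigonometric polynomials on the box. -/
noncomputable def trigPolynomial (a b : Vec n) : Subalgebra ℂ (Vec n → ℂ) :=
  Algebra.adjoin ℂ (Set.range (boxCharacter a b))

/-- Characters are closed under products. Orthogonality to them thus passes linearly to the whole
algebra, including powers of `peakPolynomial`. -/
lemma toSubmodule_trigPolynomial (a b : Vec n) :
    Subalgebra.toSubmodule (trigPolynomial a b) =
      Submodule.span ℂ (Set.range (boxCharacter a b)) := by
  let M : Submonoid (Vec n → ℂ) :=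
    { carrier := Set.range (boxCharacter a b)
      one_mem' := ⟨0, funext (boxCharacter_zero a b)⟩
      mul_mem' := by
        rintro _ _ ⟨k, rfl⟩ ⟨l, rfl⟩
        exact ⟨k + l, funext (boxCharacter_add a b k l)⟩ }
  have : Submonoid.closure (Set.range (boxCharacter a b)) = M := M.closure_eq
  rw [trigPolynomial, Algebra.adjoin_eq_span, this]
  rfl

/-- A nonnegative trigonometric polynomial on the box whose only maximum is at `x₀`. -/
noncomputable def peakPolynomial (a b x₀ x : Vec n) : ℝ :=
  1 + ∑ j, (1 + Real.cos (2 * Real.pi * ((x j - x₀ j) / (b j - a j))))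

lemma continuous_peakPolynomial (a b x₀ : Vec n) : Continuous (peakPolynomial a b x₀) := by
  unfold peakPolynomial
  fun_prop

lemma one_le_peakPolynomial (a b x₀ x : Vec n) : 1 ≤ peakPolynomial a b x₀ x := by
  unfold peakPolynomial
  have : 0 ≤ ∑ j, (1 + Real.cos (2 * Real.pi * ((x j - x₀ j) / (b j - a j)))) :=
    Finset.sum_nonneg fun j _ => by
      linarith [Real.neg_one_le_cos (2 * Real.pi * ((x j - x₀ j) / (b j - a j)))]
  linarith

/-- A second maximum would differ from `x₀` by whole periods. As `x₀` is interior to the box, every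
coordinate difference is shorter than a period. -/
lemma peakPolynomial_lt {a b x₀ x : Vec n} (hab : ∀ k, a k < b k)
    (hx₀ : ∀ k, x₀ k ∈ Set.Ioo (a k) (b k)) (hx : ∀ k, x k ∈ Set.Icc (a k) (b k))
    (hne : x ≠ x₀) : peakPolynomial a b x₀ x < peakPolynomial a b x₀ x₀ := by
  obtain ⟨j, hj⟩ : ∃ j, x j ≠ x₀ j := by
    by_contra! h
    exact hne (by ext j; exact h j)
  unfold peakPolynomial
  refine add_lt_add_right (Finset.sum_lt_sum (fun k _ => ?_) ⟨j, Finset.mem_univ _, ?_⟩) _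
  · simpa using Real.cos_le_one _
  · have hba := sub_pos.2 (hab j)
    have hlt : Real.cos (2 * Real.pi * ((x j - x₀ j) / (b j - a j))) < 1 := by
      refine lt_of_le_of_ne (Real.cos_le_one _) fun h => ?_
      rw [Real.cos_eq_one_iff] at h
      obtain ⟨m, hm⟩ := h
      have h2 : x j - x₀ j = m * (b j - a j) := by
        have hpi := Real.pi_pos
        field_simp at hm
        linarith
      have hxj := hx j
      have hx₀j := hx₀ j
      have hm1 : (m : ℝ) < 1 := by
        by_contra! hm1
        nlinarith [hxj.2, hx₀j.1]
      have hm2 : (-1 : ℝ) < m := by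
        by_contra! hm2
        nlinarith [hxj.1, hx₀j.2]
      have hm0 : m = 0 := by
        have h3 : m < 1 := by exact_mod_cast hm1
        have h4 : -1 < m := by exact_mod_cast hm2
        omega
      rw [hm0, Int.cast_zero, zero_mul] at h2
      exact hj (sub_eq_zero.1 h2)
    simpa using hlt

lemma peakPolynomial_mem (a b x₀ : Vec n) :
    (fun x => (peakPolynomial a b x₀ x : ℂ)) ∈ trigPolynomial a b := by
  have hcos : ∀ j, (fun x : Vec n =>
      (Real.cos (2 * Real.pi * ((x j - x₀ j) / (b j - a j))) : ℂ)) ∈ trigPolynomial a b := by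
    intro j
    -- The cosine is the mean of the characters of frequencies ±1, with the shift by `x₀` absorbed
    -- into the coefficients.
    have h : (fun x : Vec n => (Real.cos (2 * Real.pi * ((x j - x₀ j) / (b j - a j))) : ℂ)) =
        (boxCharacter a b (Pi.single j (-1)) x₀ / 2) • boxCharacter a b (Pi.single j 1) +
        (boxCharacter a b (Pi.single j 1) x₀ / 2) • boxCharacter a b (Pi.single j (-1)) := by
      ext x
      simp only [Pi.add_apply, Pi.smul_apply, boxCharacter_single, smul_eq_mul,
        Complex.ofReal_cos, Complex.cos]
      rw [div_mul_eq_mul_div, div_mul_eq_mul_div, ← Complex.exp_add, ← Complex.exp_add, ← add_div]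
      congr 3 <;> push_cast <;> ring_nf
    rw [h]
    have hmem : ∀ k, boxCharacter a b k ∈ trigPolynomial a b :=
      fun k => Algebra.subset_adjoin ⟨k, rfl⟩
    exact add_mem (Subalgebra.smul_mem _ (hmem _) _) (Subalgebra.smul_mem _ (hmem _) _)
  have h : (fun x => (peakPolynomial a b x₀ x : ℂ)) =
      1 + ∑ j, (1 + fun x : Vec n =>
        (Real.cos (2 * Real.pi * ((x j - x₀ j) / (b j - a j))) : ℂ)) := by
    ext x
    simp [peakPolynomial]
  rw [h]
  exact add_mem (one_mem _) (sum_mem fun j _ => add_mem (one_mem _) (hcos j))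

/-- A continuous function on a regular compact subset of the box whose Fourier coefficients all
vanish is zero. -/
theorem eq_zero_of_integral_mul_boxCharacter_eq_zero {X : Set (Vec n)} (hX : IsCompact X)
    (hXreg : closure (interior X) = X) {a b : Vec n} (hab : ∀ k, a k < b k)
    (hXbox : ∀ x ∈ X, ∀ k, x k ∈ Set.Icc (a k) (b k)) {u : Vec n → ℝ} (hu : ContinuousOn u X)
    (h : ∀ k, ∫ y in X, (u y : ℂ) * boxCharacter a b k y = 0) : ∀ x ∈ X, u x = 0 := by
  have hpoly : ∀ p ∈ trigPolynomial a b,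
      IntegrableOn (fun y => (u y : ℂ) * p y) X ∧ ∫ y in X, (u y : ℂ) * p y = 0 := by
    intro p hp
    have hp' : p ∈ Subalgebra.toSubmodule (trigPolynomial a b) := hp
    clear hp
    rw [toSubmodule_trigPolynomial] at hp'
    induction hp' using Submodule.span_induction with
    | mem p hp =>
      obtain ⟨k, rfl⟩ := hp
      exact ⟨((Complex.continuous_ofReal.comp_continuousOn hu).mul
        (continuous_boxCharacter a b k).continuousOn).integrableOn_compact hX, h k⟩
    | zero => simp
    | add p q _ _ hp hq =>
      simp only [Pi.add_apply, mul_add]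
      exact ⟨hp.1.add hq.1, by rw [integral_add hp.1 hq.1, hp.2, hq.2, add_zero]⟩
    | smul c p _ hp =>
      simp only [Pi.smul_apply, smul_eq_mul, mul_left_comm _ c]
      exact ⟨hp.1.const_mul c, by rw [integral_const_mul, hp.2, mul_zero]⟩
  have hint : ∀ x₀ ∈ interior X, u x₀ = 0 := by
    intro x₀ hx₀
    have hx₀' : ∀ k, x₀ k ∈ Set.Ioo (a k) (b k) := by
      intro k
      have hopen : IsOpen (EuclideanSpace.proj (𝕜 := ℝ) k '' interior X) := by
        refine (EuclideanSpace.proj (𝕜 := ℝ) k).isOpenMap (fun r => ?_) _ isOpen_interior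
        exact ⟨EuclideanSpace.single k r, by simp⟩
      rw [← interior_Icc]
      refine interior_maximal ?_ hopen ⟨x₀, hx₀, rfl⟩
      rintro _ ⟨y, hy, rfl⟩
      exact hXbox y (interior_subset hy) k
    -- Normalized powers of the peak polynomial concentrate at `x₀`, so the averages of `u` tend to
    -- `u x₀`; by orthogonality they are all 0.
    have hlim := tendsto_setIntegral_pow_smul_of_unique_maximum_of_isCompact_of_continuousOn
      (μ := volume) hX (continuous_peakPolynomial a b x₀).continuousOn
      (fun y hy hne => peakPolynomial_lt hab hx₀' (hXbox y hy) hne)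
      (fun y _ => zero_le_one.trans (one_le_peakPolynomial a b x₀ y))
      (zero_lt_one.trans_le (one_le_peakPolynomial a b x₀ x₀)) (subset_closure hx₀) hu
    have hzero : ∀ m : ℕ, ∫ y in X, peakPolynomial a b x₀ y ^ m • u y = 0 := by
      intro m
      have h1 := (hpoly _ (pow_mem (peakPolynomial_mem a b x₀) m)).2
      rw [← Complex.ofReal_eq_zero, ← integral_complex_ofReal, ← h1]
      refine integral_congr_ae (Eventually.of_forall fun y => ?_)
      simp [mul_comm]
    simp only [hzero, smul_zero] at hlim
    exact (tendsto_nhds_unique tendsto_const_nhds hlim).symm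
  exact Set.EqOn.of_subset_closure (g := fun _ => 0) hint hu continuousOn_const interior_subset
    hXreg.ge

end FourierSeparation

/-! ### Universality of the coefficient neural functional -/

section Functional

open scoped Topology
open Filter

variable {n ξ p : ℕ} {X : Set (Vec n)} {a b : Vec n}

/-- The function `x ↦ (f x, α)` on `X`. -/
def channelInput (q : C(X, Vec n) × Vec ξ) : X → Fin (n + ξ) → ℝ :=
  fun x => Fin.append (fun k => q.1 x k) (fun k => q.2 k)

/-- The linear functionals that a Fourier layer with `N` modes can form at the point `x₀`. -/
noncomputable def layerFunctional (a b : Vec n) (x₀ : X) {N : ℕ} (c : Modes n N → Fin p → ℂ)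
    (u : Fin p → ℝ) (h : X → Fin p → ℝ) : ℝ :=
  ∑ j, u j * h x₀ j +
    (∑ k : Modes n N, ∑ j, c k j * fourierCoefficient X a b k (fun y => h y j)
      * fourierMode a b k (x₀ : Vec n)).re

lemma layerFunctional_zero (x₀ : X) {N : ℕ} (h : X → Fin p → ℝ) :
    layerFunctional a b x₀ (0 : Modes n N → Fin p → ℂ) 0 h = 0 := by simp [layerFunctional]

lemma layerFunctional_add (x₀ : X) {N : ℕ} (c c' : Modes n N → Fin p → ℂ) (u u' : Fin p → ℝ)
    (h : X → Fin p → ℝ) : layerFunctional a b x₀ (c + c') (u + u') h =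
      layerFunctional a b x₀ c u h + layerFunctional a b x₀ c' u' h := by
  simp only [layerFunctional, Pi.add_apply, add_mul, Finset.sum_add_distrib, Complex.add_re]
  ring

lemma layerFunctional_smul (x₀ : X) {N : ℕ} (r : ℝ) (c : Modes n N → Fin p → ℂ) (u : Fin p → ℝ)
    (h : X → Fin p → ℝ) : layerFunctional a b x₀ ((r : ℂ) • c) (r • u) h =
      r * layerFunctional a b x₀ c u h := by
  simp only [layerFunctional, Pi.smul_apply, smul_eq_mul, mul_assoc, ← Finset.mul_sum,
    Complex.re_ofReal_mul, mul_add]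

/-- A Fourier neural operator with one Fourier layer has channels that at `x₀` are the activated
layer functionals. -/
lemma exists_FNO_apply_eq (X : Set (Vec n)) (a b : Vec n) (act : ℝ → ℝ) {N R : ℕ}
    (c : Fin R → Modes n N → Fin p → ℂ) (u : Fin R → Fin p → ℝ) (β : Fin R → ℝ) :
    ∃ θ : FNO n p R (p + R) N 0, ∀ h (x₀ : X) r,
      θ.apply act X a b h x₀ r = act (layerFunctional a b x₀ (c r) (u r) h + β r) := by
  classical
  -- The first `p` channels carry the input into the layer, the last `R` receive the functionals,
  -- and the projection reads only the latter.
  refine ⟨{ lift := fun i j => if i = Fin.castAdd R j then 1 else 0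
            liftBias := 0
            layers := fun _ =>
              { weight := fun i j => Fin.append 0 (fun r => Fin.append (u r) 0 j) i
                spectral := fun k i j => Fin.append 0 (fun r => Fin.append (c r k) 0 j) i
                bias := Fin.append 0 β }
            proj := fun r i => if i = Fin.natAdd p r then 1 else 0
            projBias := 0 }, fun h x₀ r => ?_⟩
  have hcast : ∀ (i j : Fin p), Fin.castAdd R i = Fin.castAdd R j ↔ j = i := fun i j => by
    rw [(Fin.castAdd_injective _ _).eq_iff, eq_comm]
  simp only [FNO.apply, List.ofFn_succ, List.ofFn_zero, List.foldl_cons, List.foldl_nil,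
    FourierLayer.apply, layerFunctional]
  simp [Fin.sum_univ_add, hcast]

/-- A coefficient neural functional with one Fourier layer and one sensor represents all
combinations of activated layer functionals. -/
lemma exists_coefficientFunctional_apply_eq (act : ℝ → ℝ) (x₀ : X) {ι : Type} {N R : ℕ}
    (c : Fin R → Modes n N → Fin (n + ξ) → ℂ) (u : Fin R → Fin (n + ξ) → ℝ) (β : Fin R → ℝ)
    (ω : ι → Fin R → ℝ) :
    ∃ θ : CoefficientFunctional X ι ξ R (n + ξ + R) N 0 1, ∀ (q : C(X, Vec n) × Vec ξ) i,
      θ.apply act a b q.1 q.2 i = ∑ r, ω i r *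
        act (layerFunctional a b x₀ (c r) (u r) (channelInput q) + β r) := by
  obtain ⟨θ, hθ⟩ := exists_FNO_apply_eq X a b act c u β
  refine ⟨⟨θ, fun _ => x₀, fun i _ r => ω i r, 0⟩, fun q i => ?_⟩
  simp only [CoefficientFunctional.apply, hθ]
  simp
  rfl

/-- The Fourier coefficient with integer frequency vector `k` of a function given on `X`. -/
noncomputable def boxCoefficient (X : Set (Vec n)) (a b : Vec n) (k : Fin n → ℤ) (v : X → ℝ) : ℂ :=
  ((∏ j, (b j - a j) : ℝ) : ℂ)⁻¹ *
    ∫ y : X, (v y : ℂ) * (starRingEnd ℂ) (boxCharacter a b k (y : Vec n))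
      ∂(Measure.comap Subtype.val volume)

lemma isFiniteMeasure_comap_subtype_val (hX : IsCompact X) :
    IsFiniteMeasure (Measure.comap (Subtype.val : X → Vec n) volume) := by
  constructor
  rw [(MeasurableEmbedding.subtype_coe hX.measurableSet).comap_apply, Set.image_univ,
    Subtype.range_coe]
  exact hX.measure_lt_top

lemma continuous_channelInput [CompactSpace X] (j : Fin (n + ξ)) :
    Continuous fun z : (C(X, Vec n) × Vec ξ) × X => channelInput z.1 z.2 j := by
  refine Fin.addCases (fun k => ?_) (fun k => ?_) j
  · simp only [channelInput, Fin.append_left]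
    fun_prop
  · simp only [channelInput, Fin.append_right]
    fun_prop

lemma continuous_boxCoefficient_channelInput [CompactSpace X] {K : Set (C(X, Vec n) × Vec ξ)}
    (hK : IsCompact K) (k : Fin n → ℤ) (j : Fin (n + ξ)) :
    Continuous fun q : K => boxCoefficient X a b k (fun y => channelInput q.1 y j) := by
  have hX : IsCompact X := isCompact_iff_compactSpace.2 inferInstance
  have : CompactSpace K := isCompact_iff_compactSpace.1 hK
  have := isFiniteMeasure_comap_subtype_val hX
  refine continuous_const.mul ?_
  have hc : Continuous fun z : K × X => (channelInput z.1.1 z.2 j : ℂ) *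
      (starRingEnd ℂ) (boxCharacter a b k (z.2 : Vec n)) := by
    have h1 := (continuous_channelInput (n := n) (ξ := ξ) (X := X) j).comp
      ((continuous_subtype_val (p := (· ∈ K))).prodMap continuous_id)
    have h2 := (continuous_boxCharacter a b k).comp
      (continuous_subtype_val.comp (continuous_snd (X := K) (Y := X)))
    exact (Complex.continuous_ofReal.comp h1).mul (Complex.continuous_conj.comp h2)
  simpa using continuous_parametric_integral_of_continuous
    (μ := Measure.comap (Subtype.val : X → Vec n) volume)
    (f := fun (q : K) (y : X) => (channelInput q.1 y j : ℂ) *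
      (starRingEnd ℂ) (boxCharacter a b k (y : Vec n))) hc isCompact_univ

/-- The continuous functions on `K` that are layer functionals for all large numbers of modes. -/
noncomputable def layerFunctionals (a b : Vec n) (x₀ : X) (K : Set (C(X, Vec n) × Vec ξ)) :
    Submodule ℝ C(K, ℝ) where
  -- Requiring all large `N` lets two members be added with a common number of modes.
  carrier := {g | ∃ N₀, ∀ N ≥ N₀, ∃ (c : Modes n N → Fin (n + ξ) → ℂ) (u : Fin (n + ξ) → ℝ),
    ∀ q : K, g q = layerFunctional a b x₀ c u (channelInput q.1)}
  zero_mem' := ⟨0, fun N _ => ⟨0, 0, fun q => (layerFunctional_zero x₀ _).symm⟩⟩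
  add_mem' := by
    rintro g g' ⟨N₀, h⟩ ⟨N₀', h'⟩
    refine ⟨max N₀ N₀', fun N hN => ?_⟩
    obtain ⟨c, u, hg⟩ := h N (le_of_max_le_left hN)
    obtain ⟨c', u', hg'⟩ := h' N (le_of_max_le_right hN)
    exact ⟨c + c', u + u', fun q => by
      rw [layerFunctional_add, ContinuousMap.add_apply, hg, hg']⟩
  smul_mem' := by
    rintro r g ⟨N₀, h⟩
    refine ⟨N₀, fun N hN => ?_⟩
    obtain ⟨c, u, hg⟩ := h N hN
    exact ⟨(r : ℂ) • c, r • u, fun q => by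
      rw [layerFunctional_smul, ContinuousMap.smul_apply, hg, smul_eq_mul]⟩

lemma exists_mem_layerFunctionals_eval [CompactSpace X] (x₀ : X) (K : Set (C(X, Vec n) × Vec ξ))
    (j : Fin (n + ξ)) :
    ∃ g ∈ layerFunctionals a b x₀ K, ∀ q : K, g q = channelInput q.1 x₀ j := by
  refine ⟨⟨fun q => channelInput q.1 x₀ j, (continuous_channelInput j).comp
    (continuous_subtype_val.prodMk continuous_const)⟩, ⟨0, fun N _ => ⟨0, Pi.single j 1,
      fun q => ?_⟩⟩, fun q => rfl⟩
  simp [layerFunctional, Pi.single_apply]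

lemma exists_mem_layerFunctionals_re [CompactSpace X] (x₀ : X) {K : Set (C(X, Vec n) × Vec ξ)}
    (hK : IsCompact K) (k : Fin n → ℤ) (j : Fin (n + ξ)) (z : ℂ) :
    ∃ g ∈ layerFunctionals a b x₀ K, ∀ q : K,
      g q = (z * boxCoefficient X a b k (fun y => channelInput q.1 y j)
        * boxCharacter a b k (x₀ : Vec n)).re := by
  classical
  refine ⟨⟨fun q => (z * boxCoefficient X a b k (fun y => channelInput q.1 y j)
    * boxCharacter a b k (x₀ : Vec n)).re, Complex.continuous_re.comp ((continuous_const.mul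
      (continuous_boxCoefficient_channelInput hK k j)).mul continuous_const)⟩,
    ⟨∑ i, (k i).natAbs, fun N hN => ?_⟩, fun q => rfl⟩
  have hk : ∀ i, k i ∈ Set.Icc (-(N : ℤ)) N := fun i => by
    have : (k i).natAbs ≤ N :=
      (Finset.single_le_sum (f := fun i => (k i).natAbs) (fun _ _ => Nat.zero_le _)
        (Finset.mem_univ i)).trans hN
    rw [Set.mem_Icc]
    omega
  let κ : Modes n N := fun i => ⟨k i, hk i⟩
  refine ⟨Pi.single κ (Pi.single j z), 0, fun q => ?_⟩
  have hsum : ∑ l : Modes n N, ∑ i, (Pi.single κ (Pi.single j z) : Modes n N → Fin (n + ξ) → ℂ) l i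
      * fourierCoefficient X a b l (fun y => channelInput q.1 y i)
      * fourierMode a b l (x₀ : Vec n) =
      z * fourierCoefficient X a b κ (fun y => channelInput q.1 y j)
        * fourierMode a b κ (x₀ : Vec n) := by
    rw [Finset.sum_eq_single κ (fun l _ hl => by simp [hl]) (by simp),
      Finset.sum_eq_single j (fun i _ hi => by simp [hi]) (by simp)]
    simp
  simp only [layerFunctional, hsum, Pi.zero_apply, zero_mul, Finset.sum_const_zero, zero_add]
  rfl

lemma exists_boxCoefficient_ne (hX : IsCompact X) (hXreg : closure (interior X) = X)
    (hab : ∀ k, a k < b k) (hXbox : ∀ x ∈ X, ∀ k, x k ∈ Set.Icc (a k) (b k)) {v w : X → ℝ}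
    (hv : Continuous v) (hw : Continuous w) (hvw : v ≠ w) :
    ∃ k, boxCoefficient X a b k v ≠ boxCoefficient X a b k w := by
  by_contra! hcon
  apply hvw
  let u : Vec n → ℝ := Function.extend Subtype.val (v - w) 0
  have hu : ∀ x : X, u x = v x - w x := fun x => Subtype.val_injective.extend_apply _ _ x
  have huc : ContinuousOn u X := by
    rw [continuousOn_iff_continuous_domRestrict]
    exact (hv.sub hw).congr fun x => (hu x).symm
  have hint : ∀ (v : X → ℝ), Continuous v → ∀ k, Integrable
      (fun y : X => (v y : ℂ) * (starRingEnd ℂ) (boxCharacter a b k (y : Vec n)))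
      (Measure.comap Subtype.val volume) := by
    intro v hv k
    have : CompactSpace X := isCompact_iff_compactSpace.1 hX
    have := isFiniteMeasure_comap_subtype_val hX
    have hc := (continuous_boxCharacter a b k).comp (continuous_subtype_val (p := (· ∈ X)))
    exact ((Complex.continuous_ofReal.comp hv).mul
      (Complex.continuous_conj.comp hc)).integrable_of_hasCompactSupport
        (HasCompactSupport.of_compactSpace _)
  have hprod : ((∏ j, (b j - a j) : ℝ) : ℂ)⁻¹ ≠ 0 := by
    refine inv_ne_zero (Complex.ofReal_ne_zero.2 (Finset.prod_pos fun j _ => ?_).ne')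
    exact sub_pos.2 (hab j)
  have hzero := eq_zero_of_integral_mul_boxCharacter_eq_zero hX hXreg hab hXbox huc fun k => by
    -- The frequency is negated because the coefficient conjugates the character.
    have h1 := sub_eq_zero.2 (mul_left_cancel₀ hprod (hcon (-k)))
    rw [← integral_sub (hint v hv _) (hint w hw _)] at h1
    rw [← integral_subtype_comap hX.measurableSet
      (f := fun y => (u y : ℂ) * boxCharacter a b k y), ← h1]
    refine integral_congr_ae (Eventually.of_forall fun y => ?_)
    simp [hu, conj_boxCharacter, sub_mul]
  ext x
  exact sub_eq_zero.1 ((hu x).symm.trans (hzero x x.2))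

lemma layerFunctionals_separate_points (hX : IsCompact X) (hXreg : closure (interior X) = X)
    (hab : ∀ k, a k < b k) (hXbox : ∀ x ∈ X, ∀ k, x k ∈ Set.Icc (a k) (b k)) (x₀ : X)
    {K : Set (C(X, Vec n) × Vec ξ)} (hK : IsCompact K) (q q' : K) (hne : q ≠ q') :
    ∃ g ∈ layerFunctionals a b x₀ K, g q ≠ g q' := by
  have : CompactSpace X := isCompact_iff_compactSpace.1 hX
  by_cases hα : q.1.2 = q'.1.2
  · have hf : q.1.1 ≠ q'.1.1 := fun hf => hne (Subtype.ext (Prod.ext hf hα))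
    obtain ⟨j, hj⟩ : ∃ j : Fin n, (fun y => q.1.1 y j) ≠ fun y => q'.1.1 y j := by
      by_contra! h
      exact hf (by ext y j; exact congrFun (h j) y)
    obtain ⟨k, hk⟩ := exists_boxCoefficient_ne hX hXreg hab hXbox
      (by fun_prop) (by fun_prop) hj
    set A := boxCoefficient X a b k fun y => q.1.1 y j
    set A' := boxCoefficient X a b k fun y => q'.1.1 y j
    have hE : boxCharacter a b k (x₀ : Vec n) ≠ 0 := Complex.exp_ne_zero _
    -- This multiplier turns the difference of the two values into a squared modulus, so taking the
    -- real part loses nothing.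
    obtain ⟨g, hg, hgq⟩ := exists_mem_layerFunctionals_re (a := a) (b := b) x₀ hK k
      (Fin.castAdd ξ j) ((starRingEnd ℂ) ((A - A') * boxCharacter a b k (x₀ : Vec n)))
    refine ⟨g, hg, fun h => ?_⟩
    rw [hgq, hgq, ← sub_eq_zero, ← Complex.sub_re, ← sub_mul, ← mul_sub] at h
    simp only [channelInput, Fin.append_left] at h
    change ((starRingEnd ℂ) ((A - A') * boxCharacter a b k (x₀ : Vec n)) * (A - A') *
      boxCharacter a b k (x₀ : Vec n)).re = 0 at h
    rw [mul_assoc, mul_comm, Complex.mul_conj, Complex.ofReal_re, Complex.normSq_eq_zero] at h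
    exact mul_ne_zero (sub_ne_zero.2 hk) hE h
  · obtain ⟨j, hj⟩ : ∃ j, q.1.2 j ≠ q'.1.2 j := by
      by_contra! h
      exact hα (by ext j; exact h j)
    obtain ⟨g, hg, hgq⟩ := exists_mem_layerFunctionals_eval (a := a) (b := b) x₀ K
      (Fin.natAdd n j)
    refine ⟨g, hg, ?_⟩
    rw [hgq, hgq]
    simpa [channelInput] using hj

/-- Coefficient neural functionals are universal approximators of continuous maps from a compact
set of inputs into a finite-dimensional space. -/
theorem exists_coefficientFunctional_approx (hX : IsCompact X) (hXreg : closure (interior X) = X)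
    (hab : ∀ k, a k < b k) (hXbox : ∀ x ∈ X, ∀ k, x k ∈ Set.Icc (a k) (b k)) (x₀ : X)
    {act : ℝ → ℝ} (hact : Continuous act)
    (hpoly : ¬ ∃ p : Polynomial ℝ, ∀ s, act s = p.eval s)
    {K : Set (C(X, Vec n) × Vec ξ)} (hK : IsCompact K) {ι : Type} [Fintype ι] (G : ι → C(K, ℝ))
    {ε : ℝ} (hε : 0 < ε) :
    ∃ (m w N D M : ℕ) (θ : CoefficientFunctional X ι ξ m w N D M), ∀ (q : K) i,
      |G i q - θ.apply act a b q.1.1 q.1.2 i| ≤ ε := by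
  classical
  have : CompactSpace K := isCompact_iff_compactSpace.1 hK
  set V := layerFunctionals a b x₀ K
  set 𝓡 : Set C(K, ℝ) := {f | ∃ g ∈ V, ∃ β : ℝ,
    f = (⟨act, hact⟩ : C(ℝ, ℝ)).comp (g + ContinuousMap.const K β)} with h𝓡
  have hdense : (Submodule.span ℝ 𝓡).topologicalClosure = ⊤ :=
    ContinuousMap.topologicalClosure_span_ridge_eq_top V
      (layerFunctionals_separate_points hX hXreg hab hXbox x₀ hK) ⟨act, hact⟩ hpoly
  have happrox : ∀ i, ∃ l : 𝓡 →₀ ℝ, ‖G i - l.sum fun f r => r • (f : C(K, ℝ))‖ < ε := by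
    intro i
    have hmem : G i ∈ closure (Submodule.span ℝ 𝓡 : Set C(K, ℝ)) := by
      rw [← Submodule.topologicalClosure_coe, hdense]
      trivial
    obtain ⟨f, hf, hfd⟩ := Metric.mem_closure_iff.1 hmem ε hε
    obtain ⟨l, rfl⟩ := (Finsupp.mem_span_iff_linearCombination ℝ 𝓡 f).1 hf
    exact ⟨l, by rwa [dist_eq_norm] at hfd⟩
  choose l hl using happrox
  -- One hidden layer serves all outputs: it contains every ridge function used by some `l i`, with
  -- a common number of modes `κ.sup N₀`.
  let κ : Finset 𝓡 := Finset.univ.biUnion fun i => (l i).support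
  have hκ : ∀ f : 𝓡, ∃ g ∈ V, ∃ β : ℝ,
    f.1 = (⟨act, hact⟩ : C(ℝ, ℝ)).comp (g + ContinuousMap.const K β) := fun f => f.2
  choose g hgV β hgβ using hκ
  choose N₀ hN₀ using hgV
  choose c u hcu using fun f (hf : f ∈ κ) =>
    hN₀ f (κ.sup N₀) (Finset.le_sup (f := N₀) hf)
  let e := κ.equivFin.symm
  obtain ⟨θ, hθ⟩ := exists_coefficientFunctional_apply_eq (a := a) (b := b) act x₀
    (fun r => c (e r) (e r).2) (fun r => u (e r) (e r).2) (fun r => β (e r))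
    (fun i r => l i (e r))
  refine ⟨_, _, _, _, _, θ, fun q i => ?_⟩
  have hθi : θ.apply act a b q.1.1 q.1.2 i = (l i).sum (fun f r => r • (f : C(K, ℝ))) q := by
    have hsub : (l i).support ⊆ κ := Finset.subset_biUnion_of_mem (fun i => (l i).support)
      (Finset.mem_univ i)
    rw [hθ, Finsupp.sum_of_support_subset _ hsub _ (by simp), ContinuousMap.coe_sum,
      Finset.sum_apply, ← Finset.sum_coe_sort κ, ← e.sum_comp]
    refine Finset.sum_congr rfl fun r _ => ?_
    rw [ContinuousMap.smul_apply, smul_eq_mul, hgβ, ← hcu]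
    rfl
  rw [hθi]
  exact (ContinuousMap.norm_coe_le_norm (G i - (l i).sum fun f r => r • (f : C(K, ℝ))) q).trans
    (hl i).le

end Functional

/-! ### Universal approximation -/

/-- A continuous family of continuous functions on `X × T` extends to a jointly continuous
function on the whole space. -/
lemma exists_jointly_continuous_extension {n : ℕ} {E : Type*} [MetricSpace E] {X : Set (Vec n)}
    {T : Set ℝ} [CompactSpace X] [CompactSpace T] {K : Set E} (hK : IsCompact K)
    {F : E → C(X × T, ℝ)} (hF : ContinuousOn F K) :
    ∃ G : C(K × (Fin n → ℝ) × ℝ, ℝ), ∀ (q : K) (x : X) (t : T),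
      G (q, fun k => (x : Vec n) k, t) = F q (x, t) := by
  have : CompactSpace K := isCompact_iff_compactSpace.1 hK
  let e : K × X × T → K × (Fin n → ℝ) × ℝ := fun z => (z.1, fun k => (z.2.1 : Vec n) k, z.2.2)
  have he : Topology.IsClosedEmbedding e := by
    refine Continuous.isClosedEmbedding (by fun_prop) ?_
    rintro ⟨q, x, t⟩ ⟨q', x', t'⟩ h
    simp only [e, Prod.mk.injEq] at h
    obtain ⟨rfl, hx, ht⟩ := h
    have : x = x' := Subtype.ext (by ext k; exact congrFun hx k)
    rw [this, Subtype.ext ht]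
  have hc : Continuous fun z : K × X × T => F z.1 z.2 := by
    have h1 : Continuous fun q : K => F q := continuousOn_iff_continuous_domRestrict.1 hF
    have h2 : Continuous fun z : K × X × T => F z.1 := h1.comp continuous_fst
    exact h2.eval continuous_snd
  -- Tietze's theorem is needed because spline nodes lie in the box but possibly outside `X` or `T`.
  obtain ⟨G, hG⟩ := ContinuousMap.exists_extension' he ⟨_, hc⟩
  exact ⟨G, fun q x t => congrFun hG (q, x, t)⟩

/-- A continuous family of functions on a box is uniformly close to its values at nearby
points of the box. -/
lemma exists_pos_abs_sub_le {K Z : Type*} [MetricSpace K] [CompactSpace K] [MetricSpace Z]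
    {Q : Set Z} (hQ : IsCompact Q) (G : C(K × Z, ℝ)) {ε : ℝ} (hε : 0 < ε) :
    ∃ δ > 0, ∀ (q : K), ∀ z ∈ Q, ∀ z' ∈ Q, dist z z' ≤ δ → |G (q, z) - G (q, z')| ≤ ε := by
  have hu := (isCompact_univ.prod hQ).uniformContinuousOn_of_continuous
    (G.continuous.continuousOn (s := (Set.univ : Set K) ×ˢ Q))
  obtain ⟨δ, hδ, h⟩ := Metric.uniformContinuousOn_iff_le.1 hu ε hε
  refine ⟨δ, hδ, fun q z hz z' hz' hd => ?_⟩
  refine h (q, z) ⟨trivial, hz⟩ (q, z') ⟨trivial, hz'⟩ ?_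
  simpa [Prod.dist_eq, hδ.le] using hd

theorem theorem1 {n ξ : ℕ}
    -- state space, time horizon, and the box on which splines and Fourier modes are scaled
    (X : Set (Vec n)) (hX : IsCompact X) (hXreg : closure (interior X) = X)
    (T : Set ℝ) (hT : IsCompact T) (hT0 : T ⊆ Set.Ici 0)
    (a b : Vec n) (hab : ∀ k, a k < b k) (hXbox : ∀ x ∈ X, ∀ k, x k ∈ Set.Icc (a k) (b k))
    (t₀ t₁ : ℝ) (ht : t₀ < t₁) (hTbox : T ⊆ Set.Icc t₀ t₁)
    -- activation function of the neural operator
    (act : ℝ → ℝ) (hact : Continuous act) (hpoly : ¬ ∃ p : Polynomial ℝ, ∀ s, act s = p.eval s)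
    -- safe sets, noise, and the classes of inputs
    (φ : Vec ξ → Vec n → ℝ) (σ : Vec n)
    (K₁ : Set C(X, Vec n)) (hK₁ : IsCompact K₁) (K₂ : Set (Vec ξ)) (hK₂ : IsCompact K₂)
    -- the stochastic system with dynamics `f` on the state space, started at each state
    (drift : C(X, Vec n) → Vec n → Vec n) (hdrift : ∀ f ∈ K₁, ∀ x : X, drift f x = f x)
    (sol : ∀ (f : K₁) (x : X), WeakSolution (drift f) σ x)
    -- the safety probability depends continuously on the inputs
    (F : C(X, Vec n) × Vec ξ → C(X × T, ℝ)) (hF : ContinuousOn F (K₁ ×ˢ K₂))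
    (hFsafe : ∀ (f : K₁), ∀ α ∈ K₂, ∀ (x : X) (t : T),
      F (f, α) (x, t) = safetyProbability (sol f x) (safeSet φ α) t)
    (ε : ℝ) (hε : 0 < ε) :
    ∃ (ℓ d : Fin n → ℕ) (ℓt dt : ℕ),
      (∀ k, 1 ≤ d k ∧ d k < ℓ k) ∧ 1 ≤ dt ∧ dt < ℓt ∧
      ∃ (m w N D M : ℕ) (θ : CoefficientFunctional X (ControlIndex ℓ ℓt) ξ m w N D M),
        ∀ (f : K₁), ∀ α ∈ K₂, ∀ (x : X) (t : T),
          |safetyProbability (sol f x) (safeSet φ α) t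
            - tensorSpline ℓ d ℓt dt a b t₀ t₁ (θ.apply act a b f α) x t| ≤ ε := by
  -- The construction needs a sensor in `X`, so the vacuous empty case is separated.
  rcases X.eq_empty_or_nonempty with rfl | ⟨x₀, hx₀⟩
  · let L : FourierLayer n 0 0 := ⟨0, 0, 0⟩
    exact ⟨fun _ => 2, fun _ => 1, 2, 1, fun _ => ⟨le_rfl, by norm_num⟩, le_rfl, by norm_num,
      0, 0, 0, 0, 0, ⟨⟨0, 0, fun _ => L, 0, 0⟩, Fin.elim0, 0, 0⟩, fun f α _ x => x.2.elim⟩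
  have : CompactSpace X := isCompact_iff_compactSpace.1 hX
  have : CompactSpace T := isCompact_iff_compactSpace.1 hT
  have hK := hK₁.prod hK₂
  have : CompactSpace ↥(K₁ ×ˢ K₂) := isCompact_iff_compactSpace.1 hK
  obtain ⟨G, hG⟩ := exists_jointly_continuous_extension hK hF
  let Q : Set ((Fin n → ℝ) × ℝ) :=
    (Set.univ.pi fun k => Set.Icc (a k) (b k)) ×ˢ Set.Icc t₀ t₁
  have hQ : IsCompact Q := (isCompact_univ_pi fun _ => isCompact_Icc).prod isCompact_Icc
  obtain ⟨δ, hδ, hGδ⟩ := exists_pos_abs_sub_le hQ G (half_pos hε)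
  -- The sum bounds every side length, so one `N` makes all mesh widths at most `δ`; `t₀ < t₁`
  -- forces `N > 0`.
  obtain ⟨N, hN⟩ := exists_nat_gt ((∑ k, (b k - a k) + (t₁ - t₀)) / δ)
  have hba : ∀ k ∈ Finset.univ, 0 ≤ b k - a k := fun k _ => sub_nonneg.2 (hab k).le
  have hL : 0 < ∑ k, (b k - a k) + (t₁ - t₀) :=
    add_pos_of_nonneg_of_pos (Finset.sum_nonneg hba) (sub_pos.2 ht)
  have hN' : (0 : ℝ) < N := (div_pos hL hδ).trans hN
  have hN0 : 0 < N := by exact_mod_cast hN'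
  rw [div_lt_iff₀ hδ] at hN
  have hδx : ∀ k, (b k - a k) / N ≤ δ := fun k => by
    rw [div_le_iff₀' hN']
    linarith [Finset.single_le_sum hba (Finset.mem_univ k)]
  have hδt : (t₁ - t₀) / N ≤ δ := by
    rw [div_le_iff₀' hN']
    linarith [Finset.sum_nonneg hba]
  let node : ControlIndex (fun _ : Fin n => N + 1) (N + 1) → (Fin n → ℝ) × ℝ :=
    fun i => (fun k => hatNode N (a k) (b k) (i.1 k), hatNode N t₀ t₁ i.2)
  have hnode : ∀ i, node i ∈ Q := fun i =>
    ⟨fun k _ => hatNode_mem_Icc (hab k) _, hatNode_mem_Icc ht _⟩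
  -- The ideal control points are the nodal values of the extension, as functions of the input.
  let C : ControlIndex (fun _ : Fin n => N + 1) (N + 1) → C(↥(K₁ ×ˢ K₂), ℝ) := fun i =>
    ⟨fun q => G (q, node i), by fun_prop⟩
  obtain ⟨m, w, N', D, M, θ, hθ⟩ := exists_coefficientFunctional_approx hX hXreg hab hXbox
    ⟨x₀, hx₀⟩ hact hpoly hK C (half_pos hε)
  refine ⟨fun _ => N + 1, fun _ => 1, N + 1, 1, fun _ => ⟨le_rfl, Nat.succ_lt_succ hN0⟩, le_rfl,
    Nat.succ_lt_succ hN0,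
    m, w, N', D, M, θ, fun f α hα x t => ?_⟩
  have hx := hXbox x x.2
  have htt := hTbox t.2
  let q : ↥(K₁ ×ˢ K₂) := ⟨(f, α), f.2, hα⟩
  refine abs_sub_tensorSpline_one_le hN0 hab ht hx htt _ fun i hi => ?_
  rw [← hFsafe f α hα x t, ← hG q x t]
  calc |G (q, fun k => (x : Vec n) k, t) - θ.apply act a b f α i|
      ≤ |G (q, fun k => (x : Vec n) k, t) - C i q| + |C i q - θ.apply act a b f α i| :=
        abs_sub_le _ _ _
    _ ≤ ε / 2 + ε / 2 := add_le_add
        (hGδ q _ ⟨fun k _ => hx k, htt⟩ _ (hnode i)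
          (dist_hatNode_le hN0 hab ht hi hδ.le hδx hδt)) (hθ q i)
    _ = ε := add_halves ε
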